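/- A poset is regarded as a topological space whose open sets are its lower sets; the spaces so obtained are exactly the $T_0$ Alexandroff spaces ($T_0$ spaces in which arbitrary intersections of open sets are open). For a topological space $X$, let $\mathrm{Aut}(X)$ be the group of self-homeomorphisms of $X$, and let $\mathcal{E}(X)$ be the group of homotopy classes of self-homotopy equivalences of $X$ (both under composition). Let $G$ and $H$ be two groups. There exists a topological space $X_H^G$, which is a $T_0$ Alexandroff space (a poset), such that $\mathrm{Aut}(X_H^G)\cong G$ and $\mathcal{E}(X_H^G)\cong H$. Moreover, $X_H^G$ can be chosen as follows: there are posets $X_*^G$ and $X_H^*$ with $X_H^G = X_H^*\cup X_*^G$ and $X_H^*\cap X_*^G=\{*\}$, such that 1. $*$ is the minimum of $X_*^G$, the space $X_*^G$ is contractible, and $\mathrm{Aut}(X_*^G)\cong G$; 2. $\mathrm{Aut}(X_H^*)$ is trivial and $\mathcal{E}(X_H^*)\cong H$; 3. the order of $X_H^G$ restricts to the given orders of $X_H^*$ and $X_*^G$, and for $x\in X_H^*$ and $y\in X_*^G$ one has $x\le y$ if and only if $x\le *$ and $*\le y$, and $y\le x$ if and only if $y\le *$ and $*\le x$. -/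

import Mathlib

universe u v

open scoped ContinuousMap

/-- Self-homotopy equivalences of `X`, up to homotopy of the underlying maps. -/
instance selfHomotopyEquivSetoid (X : Type*) [TopologicalSpace X] : Setoid (X ≃ₕ X) where
  r f g := ContinuousMap.Homotopic f.toFun g.toFun
  iseqv :=
    { refl := fun f => ContinuousMap.Homotopic.refl f.toFun
      symm := fun h => ContinuousMap.Homotopic.symm h
      trans := fun h k => ContinuousMap.Homotopic.trans h k }

/-- `ℰ(X)`: the set of homotopy classes of self-homotopy equivalences of `X`. -/
def SelfHomotopyGroup (X : Type*) [TopologicalSpace X] : Type _ :=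
  Quotient (selfHomotopyEquivSetoid X)

namespace SelfHomotopyGroup

variable {X : Type*} [TopologicalSpace X]

/-- Homotopic homotopy equivalences have homotopic homotopy inverses. -/
theorem homotopic_symm {f g : X ≃ₕ X} (h : ContinuousMap.Homotopic f.toFun g.toFun) :
    ContinuousMap.Homotopic f.invFun g.invFun := by
  have h1 : ContinuousMap.Homotopic f.invFun ((f.invFun.comp g.toFun).comp g.invFun) := by
    have := (ContinuousMap.Homotopic.refl f.invFun).comp g.right_inv.symm
    rwa [ContinuousMap.comp_id] at this
  have h2 : ContinuousMap.Homotopic ((f.invFun.comp g.toFun).comp g.invFun)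
      ((f.invFun.comp f.toFun).comp g.invFun) :=
    ((ContinuousMap.Homotopic.refl f.invFun).comp h.symm).comp
      (ContinuousMap.Homotopic.refl g.invFun)
  have h3 : ContinuousMap.Homotopic ((f.invFun.comp f.toFun).comp g.invFun) g.invFun := by
    have := f.left_inv.comp (ContinuousMap.Homotopic.refl g.invFun)
    rwa [ContinuousMap.id_comp] at this
  exact (h1.trans h2).trans h3

/-- The group structure on `ℰ(X)`: `[f] * [g] = [f ∘ g]`, the unit is the class of the identity,
and `[f]⁻¹` is the class of a homotopy inverse of `f`. -/
instance : Group (SelfHomotopyGroup X) where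
  mul := Quotient.map₂ (fun f g => g.trans f) (fun _ _ hf _ _ hg =>
    ContinuousMap.Homotopic.comp hf hg)
  one := Quotient.mk _ (ContinuousMap.HomotopyEquiv.refl X)
  inv := Quotient.map (fun f => f.symm) (fun _ _ h => homotopic_symm h)
  mul_assoc := by
    rintro ⟨f⟩ ⟨g⟩ ⟨h⟩
    exact Quotient.sound (ContinuousMap.Homotopic.refl _)
  one_mul := by
    rintro ⟨f⟩
    exact Quotient.sound (ContinuousMap.Homotopic.refl _)
  mul_one := by
    rintro ⟨f⟩
    exact Quotient.sound (ContinuousMap.Homotopic.refl _)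
  inv_mul_cancel := by
    rintro ⟨f⟩
    exact Quotient.sound f.left_inv

end SelfHomotopyGroup

/-- The poset `X` is obtained from the posets `Y` and `Z` by identifying `y₀ : Y` with `z₀ : Z`:
`X` is the union of order-embedded copies of `Y` and `Z` that meet exactly in the common point `*`,
and elements of different copies are comparable exactly when this follows by transitivity
through `*`. -/
structure IsPointGluing {X Y Z : Type*} [PartialOrder X] [PartialOrder Y] [PartialOrder Z]
    (i : Y ↪o X) (j : Z ↪o X) (y₀ : Y) (z₀ : Z) : Prop where
  union_eq : Set.range i ∪ Set.range j = Set.univ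
  inter_eq : Set.range i ∩ Set.range j = {i y₀}
  base_eq : i y₀ = j z₀
  right_le_left_iff : ∀ (z : Z) (y : Y), j z ≤ i y ↔ z ≤ z₀ ∧ y₀ ≤ y
  left_le_right_iff : ∀ (y : Y) (z : Z), i y ≤ j z ↔ y ≤ y₀ ∧ z₀ ≤ z

/-!
# Realizing two groups as automorphisms and as homotopy classes of one poset

Posets carry the topology of lower sets, so that continuous maps are monotone maps, and comparable
maps are homotopic (`ContinuousMap.homotopic_of_le`).

The construction starts from the Cayley poset of a group `H` with a well-order
(`CayleyPoset`). Each ordered pair `(g, k)` gives an arc above a source `g` and a target `k`, and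
its colour `g⁻¹ * k` is recorded by elements `bound a` that lie above the arcs of colour at most
`a`. As a well-order has no automorphism but the identity, every automorphism of the poset preserves
colours, and hence is a left translation (`CayleyPoset.exists_eq_translateHom`). So the
automorphism group is `H`.

A few further elements ensure that every point lies in a finite set with no beat points
(`DownTaut`, `UpTaut`). The times at which a homotopy fixes such a set form an open and closed set:
near such a time the points can only be lowered, and in the limit they can only be raised, and both
are impossible. By connectedness of the interval, a homotopy that starts at the identity is
constant (`eq_id_of_homotopic_id`). Consequently homotopy equivalences are automorphisms and homotopic ones coincide: `ℰ` of the Cayley poset is also `H`.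

Attaching a poset `T` above `P` along a monotone map `T → P` (`MapCylinder`) does not change the
homotopy type, since the retraction to `P` lies below the identity. This is used three times:

* `Z` is the Cayley poset of `H` with a chain attached above each source `g`, of the order type of
  the initial segment `Set.Iic g`. Different chains are not isomorphic, which kills all
  translations: `Z` is rigid (`RigidCayleyPoset.subsingleton_orderIso`), and still `ℰ(Z) ≅ H`.
* `Y` is the Cayley poset of `G` attached above a point, that is, with a minimum added.
* `X` is the Cayley poset of `G` attached above the element `top` of `Z`. This is the only element
  of `Z` above all minimal elements, so every automorphism of `X` preserves both parts, is
  trivial on the rigid part `Z`, and amounts to an automorphism of the Cayley poset of `G`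
  (`MapCylinder.nonempty_orderIso_mulEquiv_of_const`).
-/

/-! ### Taut subsets of posets -/

section Taut

variable {X : Type*} [PartialOrder X]

/-- Every element `x` of `F` that is not minimal lies above two elements of `F` that have no common
upper bound strictly below `x`. -/
def DownTaut (F : Set X) : Prop :=
  ∀ x ∈ F, IsMin x ∨ ∃ a ∈ F, ∃ b ∈ F, a < x ∧ b < x ∧ ∀ z < x, a ≤ z → ¬ b ≤ z

/-- Every element `x` of `F` that is not maximal lies below two elements of `F` that have no common
lower bound strictly above `x`. -/
def UpTaut (F : Set X) : Prop :=
  ∀ x ∈ F, IsMax x ∨ ∃ a ∈ F, ∃ b ∈ F, x < a ∧ x < b ∧ ∀ z, x < z → z ≤ a → ¬ z ≤ b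

/-- A monotone map that sends each element of a finite set `F` as above to an element below it fixes
`F`: at an element that is minimal among those moved, the two elements below it are fixed, so that
its image is a common upper bound of them. -/
theorem DownTaut.eq_of_le {F : Set X} (hF : DownTaut F) (hfin : F.Finite) {g : X → X}
    (hg : Monotone g) (hle : ∀ x ∈ F, g x ≤ x) : ∀ x ∈ F, g x = x := by
  by_contra! hne
  obtain ⟨x, ⟨hxF, hx⟩, hmin⟩ :=
    (hfin.subset (Set.sep_subset F fun x => g x ≠ x)).exists_minimal hne
  have hlt : g x < x := lt_of_le_of_ne (hle x hxF) hx
  have hfix : ∀ y ∈ F, y < x → g y = y := fun y hy hyx => by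
    by_contra h
    exact hyx.not_ge (hmin ⟨hy, h⟩ hyx.le)
  obtain h | ⟨a, ha, b, hb, hax, hbx, hab⟩ := hF x hxF
  · exact h.not_lt hlt
  · exact hab (g x) hlt ((hfix a ha hax).symm.le.trans (hg hax.le))
      ((hfix b hb hbx).symm.le.trans (hg hbx.le))

theorem UpTaut.eq_of_le {F : Set X} (hF : UpTaut F) (hfin : F.Finite) {g : X → X}
    (hg : Monotone g) (hle : ∀ x ∈ F, x ≤ g x) : ∀ x ∈ F, g x = x :=
  DownTaut.eq_of_le (X := Xᵒᵈ) (F := OrderDual.ofDual ⁻¹' F) (g := g)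
    (fun x hx => hF x hx) hfin hg.dual hle

end Taut

/-! ### Homotopies between maps into posets with the topology of lower sets -/

section LowerSetHomotopy

variable {X Y : Type*} [PartialOrder X] [TopologicalSpace X] [Topology.IsLowerSet X]
  [PartialOrder Y] [TopologicalSpace Y] [Topology.IsLowerSet Y]

theorem Topology.IsLowerSet.monotone (f : C(X, Y)) : Monotone f :=
  Topology.IsLowerSet.monotone_iff_continuous.mpr f.continuous

theorem Topology.IsLowerSet.t0Space : T0Space X where
  t0 _ _ h := le_antisymm (Topology.IsLowerSet.specializes_iff_le.mp h.specializes)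
    (Topology.IsLowerSet.specializes_iff_le.mp h.specializes')

/-- Comparable maps are homotopic: the homotopy from `f ≤ g` to `g` equals `f` at all times before
the last one, where it jumps up to `g`. -/
theorem ContinuousMap.homotopic_of_le {W : Type*} [TopologicalSpace W] {f g : C(W, Y)}
    (h : ∀ x, f x ≤ g x) : f.Homotopic g := by
  classical
  refine ⟨⟨⟨fun p => if p.1 = 1 then g p.2 else f p.2, ?_⟩, ?_, ?_⟩⟩
  · refine continuous_def.mpr fun U hU => ?_
    have hL := Topology.IsLowerSet.isOpen_iff_isLowerSet.mp hU
    have : (fun p : unitInterval × W => if p.1 = 1 then g p.2 else f p.2) ⁻¹' U =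
        ({1}ᶜ ×ˢ (f ⁻¹' U)) ∪ (Set.univ ×ˢ (g ⁻¹' U)) := by
      ext ⟨t, x⟩
      by_cases ht : t = 1
      · simp [ht]
      · have : g x ∈ U → f x ∈ U := fun hg => hL (h x) hg
        simpa [ht] using this
    rw [this]
    exact (isOpen_compl_singleton.prod (hU.preimage f.continuous)).union
      (isOpen_univ.prod (hU.preimage g.continuous))
  · intro x
    simp
  · intro x
    simp

/-- If the points of a poset lie in finite taut sets, then the identity is alone in its
homotopy class: on a finite taut set `F`, the times at which a homotopy fixes `F` form a clopen
set. -/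
theorem eq_id_of_homotopic_id
    (hX : ∀ x : X, ∃ F : Set X, x ∈ F ∧ F.Finite ∧ DownTaut F ∧ UpTaut F)
    {f : C(X, X)} (hf : f.Homotopic (ContinuousMap.id X)) : f = ContinuousMap.id X := by
  obtain ⟨K⟩ := hf.symm
  ext x
  obtain ⟨F, hxF, hfin, hD, hU⟩ := hX x
  have hmono : ∀ t, Monotone fun y => K (t, y) := fun t =>
    Topology.IsLowerSet.monotone (K.curry t)
  have hnear : ∀ t, ∀ᶠ s in nhds t, ∀ y ∈ F, K (s, y) ≤ K (t, y) := fun t => by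
    refine (Filter.eventually_all_finite hfin).mpr fun y _ => ?_
    have hc : Continuous fun s => K (s, y) := by fun_prop
    have hO : IsOpen (Set.Iic (K (t, y))) :=
      Topology.IsLowerSet.isOpen_iff_isLowerSet.mpr (isLowerSet_Iic _)
    exact hc.continuousAt.eventually (hO.mem_nhds (Set.mem_Iic.mpr le_rfl))
  have hclopen : IsClopen {t | ∀ y ∈ F, K (t, y) = y} := by
    refine ⟨isClosed_iff_frequently.mpr fun t ht => ?_, isOpen_iff_mem_nhds.mpr fun t ht => ?_⟩
    · obtain ⟨s, hs, hst⟩ := (ht.and_eventually (hnear t)).exists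
      exact hU.eq_of_le hfin (hmono t) fun y hy => (hs y hy).symm.le.trans (hst y hy)
    · filter_upwards [hnear t] with s hs
      exact hD.eq_of_le hfin (hmono s) fun y hy => (hs y hy).trans (ht y hy).le
  have huniv := hclopen.eq_univ ⟨0, fun y _ => by simp⟩
  have h1 : (1 : unitInterval) ∈ {t | ∀ y ∈ F, K (t, y) = y} := huniv ▸ Set.mem_univ _
  simpa using h1 x hxF

/-- For the topologies of lower sets, homeomorphisms and order isomorphisms coincide. -/
def homeomorphMulEquivOrderIso : (X ≃ₜ X) ≃* (X ≃o X) where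
  toFun f :=
    { toEquiv := f.toEquiv
      map_rel_iff' := fun {a b} => ⟨fun h => by
        simpa using Topology.IsLowerSet.monotone (f.symm : C(X, X)) h,
        fun h => Topology.IsLowerSet.monotone (f : C(X, X)) h⟩ }
  invFun f :=
    { toEquiv := f.toEquiv
      continuous_toFun := Topology.IsLowerSet.monotone_iff_continuous.mp f.monotone
      continuous_invFun := Topology.IsLowerSet.monotone_iff_continuous.mp f.symm.monotone }
  left_inv _ := rfl
  right_inv _ := rfl
  map_mul' _ _ := rfl

end LowerSetHomotopy

/-! ### The group of self-homotopy equivalences -/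

namespace SelfHomotopyGroup

open ContinuousMap

/-- Conjugation by a homotopy equivalence. -/
def congr {X Y : Type*} [TopologicalSpace X] [TopologicalSpace Y] (e : X ≃ₕ Y) :
    SelfHomotopyGroup X ≃* SelfHomotopyGroup Y where
  toFun := Quotient.map (fun f => (e.symm.trans f).trans e) fun _ _ h =>
    (Homotopic.refl e.toFun).comp (h.comp (Homotopic.refl e.invFun))
  invFun := Quotient.map (fun f => (e.trans f).trans e.symm) fun _ _ h =>
    (Homotopic.refl e.invFun).comp (h.comp (Homotopic.refl e.toFun))
  left_inv := by
    rintro ⟨f⟩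
    exact Quotient.sound
      (e.left_inv.comp ((Homotopic.refl f.toFun).comp e.left_inv))
  right_inv := by
    rintro ⟨f⟩
    exact Quotient.sound
      (e.right_inv.comp ((Homotopic.refl f.toFun).comp e.right_inv))
  map_mul' := by
    rintro ⟨f⟩ ⟨g⟩
    exact Quotient.sound ((((Homotopic.refl e.toFun).comp (Homotopic.refl f.toFun)).comp
      (e.left_inv.symm.comp ((Homotopic.refl g.toFun).comp (Homotopic.refl e.invFun)))))

/-- If the identity of `X` is alone in its homotopy class, then homotopy equivalences of `X` are
homeomorphisms, and homotopic ones are equal. -/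
theorem nonempty_homeomorph_mulEquiv {X : Type*} [TopologicalSpace X]
    (hX : ∀ f : C(X, X), f.Homotopic (ContinuousMap.id X) → f = ContinuousMap.id X) :
    Nonempty ((X ≃ₜ X) ≃* SelfHomotopyGroup X) := by
  let Φ : (X ≃ₜ X) →* SelfHomotopyGroup X :=
    { toFun := fun f => Quotient.mk _ f.toHomotopyEquiv
      map_one' := rfl
      map_mul' := fun _ _ => rfl }
  refine ⟨MulEquiv.ofBijective Φ ⟨(injective_iff_map_eq_one Φ).mpr fun f hf => ?_, ?_⟩⟩
  · have h := hX f (Quotient.exact hf)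
    exact Homeomorph.ext fun x => DFunLike.congr_fun h x
  · rintro ⟨f⟩
    have h1 := hX _ f.left_inv
    have h2 := hX _ f.right_inv
    refine ⟨⟨⟨f.toFun, f.invFun, DFunLike.congr_fun h1, DFunLike.congr_fun h2⟩,
      f.toFun.continuous, f.invFun.continuous⟩, ?_⟩
    exact Quotient.sound (Homotopic.refl _)

end SelfHomotopyGroup

/-! ### Mapping cylinders of posets -/

/-- The (non-Hausdorff) mapping cylinder of a monotone map `c : T →o P`: the disjoint union of `P`
and `T`, where an element `t` of `T` lies above the elements of `P` below `c t`. -/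
inductive MapCylinder {P : Type u} {T : Type v} [PartialOrder P] [PartialOrder T] (c : T →o P) :
    Type (max u v)
  | base (x : P) : MapCylinder c
  | tail (t : T) : MapCylinder c

namespace MapCylinder

variable {P : Type u} {T : Type v} [PartialOrder P] [PartialOrder T] {c : T →o P}

instance : PartialOrder (MapCylinder c) where
  le
    | base x, base y => x ≤ y
    | base x, tail t => x ≤ c t
    | tail _, base _ => False
    | tail s, tail t => s ≤ t
  le_refl
    | base x => le_refl x
    | tail t => le_refl t
  le_trans
    | base _, base _, base _ => le_trans
    | base _, base _, tail _ => le_trans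
    | base _, tail _, tail _ => fun h k => le_trans h (c.monotone k)
    | tail _, tail _, tail _ => le_trans
    | _, tail _, base _ => fun _ k => k.elim
    | tail _, base _, _ => fun h _ => h.elim
  le_antisymm
    | base _, base _ => fun h k => congrArg base (le_antisymm h k)
    | tail _, tail _ => fun h k => congrArg tail (le_antisymm h k)
    | base _, tail _ => fun _ k => k.elim
    | tail _, base _ => fun h _ => h.elim

@[simp] theorem base_le_base {x y : P} : (base x : MapCylinder c) ≤ base y ↔ x ≤ y := Iff.rfl
@[simp] theorem base_le_tail {x : P} {t : T} : (base x : MapCylinder c) ≤ tail t ↔ x ≤ c t :=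
  Iff.rfl
@[simp] theorem not_tail_le_base {t : T} {x : P} : ¬ (tail t : MapCylinder c) ≤ base x := id
@[simp] theorem tail_le_tail {s t : T} : (tail s : MapCylinder c) ≤ tail t ↔ s ≤ t := Iff.rfl

instance : TopologicalSpace (MapCylinder c) := Topology.lowerSet _

instance : Topology.IsLowerSet (MapCylinder c) := ⟨rfl⟩

theorem isMin_iff {w : MapCylinder c} : IsMin w ↔ ∃ x : P, IsMin x ∧ base x = w := by
  constructor
  · obtain x | t := w
    · exact fun h => ⟨x, fun y hy => h (b := base y) hy, rfl⟩
    · exact fun h => (h (b := base (c t)) (le_refl (c t))).elim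
  · rintro ⟨x, hx, rfl⟩ (y | t) h
    · exact hx h
    · exact h.elim

/-- The mapping cylinder retracts onto its base, by a map that lies below the identity. -/
theorem nonempty_homotopyEquiv [TopologicalSpace P] [Topology.IsLowerSet P] :
    Nonempty (MapCylinder c ≃ₕ P) := by
  let r : C(MapCylinder c, P) :=
    { toFun := fun w => match w with
        | base x => x
        | tail t => c t
      continuous_toFun := Topology.IsLowerSet.monotone_iff_continuous.mp <| by
        rintro (x | s) (y | t) h
        · exact h
        · exact h
        · exact h.elim
        · exact c.monotone h }
  let i : C(P, MapCylinder c) :=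
    { toFun := base
      continuous_toFun := Topology.IsLowerSet.monotone_iff_continuous.mp fun _ _ h => h }
  refine ⟨⟨r, i, ContinuousMap.homotopic_of_le ?_, ContinuousMap.Homotopic.refl _⟩⟩
  rintro (x | t)
  · exact le_refl x
  · exact le_refl (c t)

/-- An automorphism of the base and an automorphism of the tail that are compatible with `c`
assemble to an automorphism of the mapping cylinder. -/
def orderIso (σ : P ≃o P) (τ : T ≃o T) (h : ∀ t, c (τ t) = σ (c t)) :
    MapCylinder c ≃o MapCylinder c where
  toFun
    | base x => base (σ x)
    | tail t => tail (τ t)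
  invFun
    | base x => base (σ.symm x)
    | tail t => tail (τ.symm t)
  left_inv := by rintro (x | t) <;> simp
  right_inv := by rintro (x | t) <;> simp
  map_rel_iff' := by rintro (x | t) (y | s) <;> simp [h]

/-- An automorphism of the mapping cylinder that preserves the base arises from compatible
automorphisms of the base and of the tail. -/
theorem exists_eq_orderIso (φ : MapCylinder c ≃o MapCylinder c)
    (hφ : ∀ w, w ∈ Set.range (base (c := c)) ↔ φ w ∈ Set.range (base (c := c))) :
    ∃ (σ : P ≃o P) (τ : T ≃o T) (h : ∀ t, c (τ t) = σ (c t)), φ = orderIso σ τ h := by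
  have hb : ∀ x : P, ∃ y, base y = φ (base x) := fun x => (hφ (base x)).mp ⟨x, rfl⟩
  have hb' : ∀ x : P, ∃ y, base y = φ.symm (base x) := fun x =>
    (hφ _).mpr ⟨x, (φ.apply_symm_apply _).symm⟩
  have ht : ∀ t : T, ∃ s, tail s = φ (tail t) := fun t => by
    rcases h : φ (tail t) with x | s
    · obtain ⟨y, hy⟩ := (hφ (tail t)).mpr ⟨x, h.symm⟩
      cases hy
    · exact ⟨s, rfl⟩
  have ht' : ∀ t : T, ∃ s, tail s = φ.symm (tail t) := fun t => by
    rcases h : φ.symm (tail t) with x | s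
    · obtain ⟨y, hy⟩ := (hφ (base x)).mp ⟨x, rfl⟩
      rw [← h, φ.apply_symm_apply] at hy
      cases hy
    · exact ⟨s, rfl⟩
  choose f hf using hb
  choose f' hf' using hb'
  choose g hg using ht
  choose g' hg' using ht'
  let σ : P ≃o P :=
    { toFun := f
      invFun := f'
      left_inv := fun x => base.inj (c := c) (by rw [hf', hf, φ.symm_apply_apply])
      right_inv := fun x => base.inj (c := c) (by rw [hf, hf', φ.apply_symm_apply])
      map_rel_iff' := fun {x y} => by
        change f x ≤ f y ↔ x ≤ y
        rw [← base_le_base (c := c), hf, hf, φ.le_iff_le, base_le_base] }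
  let τ : T ≃o T :=
    { toFun := g
      invFun := g'
      left_inv := fun x => tail.inj (c := c) (by rw [hg', hg, φ.symm_apply_apply])
      right_inv := fun x => tail.inj (c := c) (by rw [hg, hg', φ.apply_symm_apply])
      map_rel_iff' := fun {x y} => by
        change g x ≤ g y ↔ x ≤ y
        rw [← tail_le_tail (c := c), hg, hg, φ.le_iff_le, tail_le_tail] }
  have key : ∀ x t, x ≤ c (τ t) ↔ x ≤ σ (c t) := fun x t => by
    rw [← σ.apply_symm_apply x, σ.le_iff_le, ← base_le_tail (c := c), ← base_le_tail (c := c)]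
    change base (f _) ≤ tail (g t) ↔ _
    rw [hf, hg, φ.le_iff_le]
  refine ⟨σ, τ, fun t => le_antisymm ((key _ t).mp le_rfl) ((key _ t).mpr le_rfl), ?_⟩
  ext (x | t)
  · exact (hf x).symm
  · exact (hg t).symm

/-! ### Attaching a poset above a point -/

section Cone

variable {A : Type v} [PartialOrder A] {z₀ : P}

/-- If `z₀` is the only element of `P` above all minimal elements, then every automorphism of the
poset obtained by attaching `A` above `z₀` preserves `A`: the elements above all
minimal elements are `z₀` and those of `A`, and `z₀` is the least of them. -/
theorem mem_range_base_iff_of_const (hz : ∀ z : P, (∀ w, IsMin w → w ≤ z) ↔ z = z₀)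
    (φ : MapCylinder (OrderHom.const A z₀) ≃o MapCylinder (OrderHom.const A z₀))
    (w : MapCylinder (OrderHom.const A z₀)) :
    w ∈ Set.range (base (c := OrderHom.const A z₀)) ↔
      φ w ∈ Set.range (base (c := OrderHom.const A z₀)) := by
  let D : MapCylinder (OrderHom.const A z₀) → Prop := fun x => ∀ w, IsMin w → w ≤ x
  have hDb : ∀ z : P, D (base z) ↔ z = z₀ := fun z => by
    rw [← hz]
    refine ⟨fun h w hw => h (base w) (isMin_iff.mpr ⟨w, hw, rfl⟩), fun h w hw => ?_⟩
    obtain ⟨x, hx, rfl⟩ := isMin_iff.mp hw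
    exact h x hx
  have hchar : ∀ x, x ∈ Set.range (base (c := OrderHom.const A z₀)) ↔ ¬ ∃ y < x, D y := by
    rintro (z | t)
    · refine ⟨fun _ => ?_, fun _ => ⟨z, rfl⟩⟩
      rintro ⟨y | t, hy, hyD⟩
      · have h1 := (hDb y).mp hyD
        have h2 := (hDb z).mp fun w hw => (hyD w hw).trans hy.le
        exact hy.ne (by rw [h1, h2])
      · exact hy.le.elim
    · refine ⟨fun ⟨x, hx⟩ => (by cases hx), fun h => (h ⟨base z₀, ?_, (hDb z₀).mpr rfl⟩).elim⟩
      exact lt_of_le_not_ge (le_refl z₀) id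
  have hDφ : ∀ x, D (φ x) ↔ D x := fun x => by
    refine ⟨fun h w hw => ?_, fun h w hw => ?_⟩
    · exact φ.le_iff_le.mp (h _ ((φ.isMin_apply).mpr hw))
    · exact φ.symm_apply_le.mp (h _ (φ.symm.isMin_apply.mpr hw))
  rw [hchar, hchar, not_iff_not]
  constructor
  · rintro ⟨y, hy, hyD⟩
    exact ⟨φ y, φ.lt_iff_lt.mpr hy, (hDφ y).mpr hyD⟩
  · rintro ⟨y, hy, hyD⟩
    exact ⟨φ.symm y, φ.symm_apply_lt.mpr hy, (hDφ _).mp (by rwa [φ.apply_symm_apply])⟩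

/-- If moreover `P` is rigid, then only the automorphisms of `A` remain. -/
theorem nonempty_orderIso_mulEquiv_of_const [Subsingleton (P ≃o P)]
    (hz : ∀ z : P, (∀ w, IsMin w → w ≤ z) ↔ z = z₀) :
    Nonempty ((MapCylinder (OrderHom.const A z₀) ≃o MapCylinder (OrderHom.const A z₀)) ≃*
      (A ≃o A)) := by
  let Φ : (A ≃o A) →*
      (MapCylinder (OrderHom.const A z₀) ≃o MapCylinder (OrderHom.const A z₀)) :=
    { toFun := fun τ => orderIso 1 τ fun _ => rfl
      map_one' := by ext (x | t) <;> rfl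
      map_mul' := fun _ _ => by ext (x | t) <;> rfl }
  refine ⟨(MulEquiv.ofBijective Φ ⟨fun σ τ h => ?_, fun φ => ?_⟩).symm⟩
  · ext a
    exact tail.inj (DFunLike.congr_fun h (tail a))
  · obtain ⟨σ, τ, h, rfl⟩ := exists_eq_orderIso φ (mem_range_base_iff_of_const hz φ)
    obtain rfl : σ = 1 := Subsingleton.elim _ _
    exact ⟨τ, rfl⟩

end Cone

end MapCylinder

/-! ### A poset with prescribed automorphism group and no further homotopy classes -/

/-- The elements of the Cayley poset of a group `H` carrying a linear order. It encodes
the coloured Cayley graph of `H`: every ordered pair `(g, k)` is an arc, with colour `g⁻¹ * k`.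

* `arc g k` lies above its source `vert false g` and its target `vert true k`;
* `bound a` lies above the arcs of colour at most `a`;
* `cap false` lies above all sources and `cap true` above all targets;
* `top` lies above the arcs, the sources and targets, and both feet;
* `foot b` lies below `cap b`, and `foot false` lies below all `bound a`. -/
inductive CayleyPoset (H : Type u) : Type u
  | vert (b : Bool) (g : H) : CayleyPoset H
  | foot (b : Bool) : CayleyPoset H
  | cap (b : Bool) : CayleyPoset H
  | arc (g k : H) : CayleyPoset H
  | bound (a : H) : CayleyPoset H
  | top : CayleyPoset H

namespace CayleyPoset

variable {H : Type u} [Group H]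

/-- Left translation by `h`. -/
def translate (h : H) : CayleyPoset H → CayleyPoset H
  | vert b g => vert b (h * g)
  | foot b => foot b
  | cap b => cap b
  | arc g k => arc (h * g) (h * k)
  | bound a => bound a
  | top => top

theorem translate_mul (h h' : H) (x : CayleyPoset H) :
    translate (h * h') x = translate h (translate h' x) := by
  cases x <;> simp [translate, mul_assoc]

theorem translate_one (x : CayleyPoset H) : translate 1 x = x := by
  cases x <;> simp [translate]

variable [LinearOrder H]

/-- The order relation of the Cayley poset. -/
def le : CayleyPoset H → CayleyPoset H → Prop
  | vert b g, vert b' g' => b = b' ∧ g = g'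
  | vert b _, cap b' => b = b'
  | vert b g, arc g' k' => g = bif b then k' else g'
  | vert _ _, bound _ => True
  | vert _ _, top => True
  | foot b, foot b' => b = b'
  | foot b, cap b' => b = b'
  | foot b, bound _ => b = false
  | foot _, top => True
  | cap b, cap b' => b = b'
  | arc g k, arc g' k' => g = g' ∧ k = k'
  | arc g k, bound a => g⁻¹ * k ≤ a
  | arc _ _, top => True
  | bound a, bound a' => a = a'
  | top, top => True
  | _, _ => False

instance : PartialOrder (CayleyPoset H) where
  le := le
  le_refl x := by cases x <;> simp [le]
  le_trans x y z h k := by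
    cases y <;> cases x <;> simp only [le] at h <;> cases z <;> simp_all [le]
  le_antisymm x y h k := by
    cases x <;> cases y <;> simp_all [le]

theorem le_iff {x y : CayleyPoset H} : x ≤ y ↔ le x y := Iff.rfl

instance : TopologicalSpace (CayleyPoset H) := Topology.lowerSet _

instance : Topology.IsLowerSet (CayleyPoset H) := ⟨rfl⟩

theorem isMin_vert (b : Bool) (g : H) : IsMin (vert b g) := by
  rintro (_ | _ | _ | _ | _ | _) h <;> simp_all [le_iff, le]

theorem isMin_foot (b : Bool) : IsMin (foot b : CayleyPoset H) := by
  rintro (_ | _ | _ | _ | _ | _) h <;> simp_all [le_iff, le]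

theorem isMax_cap (b : Bool) : IsMax (cap b : CayleyPoset H) := by
  rintro (_ | _ | _ | _ | _ | _) h <;> simp_all [le_iff, le]

theorem isMax_bound (a : H) : IsMax (bound a) := by
  rintro (_ | _ | _ | _ | _ | _) h <;> simp_all [le_iff, le]

theorem isMax_top : IsMax (top : CayleyPoset H) := by
  rintro (_ | _ | _ | _ | _ | _) h <;> simp_all [le_iff, le]

theorem exists_eq_arc_iff {x : CayleyPoset H} :
    (∃ g k, x = arc g k) ↔ ¬ IsMin x ∧ ¬ IsMax x := by
  constructor
  · rintro ⟨g, k, rfl⟩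
    exact ⟨fun h => by simpa [le_iff, le] using h (b := vert false g) (by simp [le_iff, le]),
      fun h => by simpa [le_iff, le] using h (b := top) (by simp [le_iff, le])⟩
  · rintro ⟨h, h'⟩
    cases x
    · exact (h (isMin_vert _ _)).elim
    · exact (h (isMin_foot _)).elim
    · exact (h' (isMax_cap _)).elim
    · exact ⟨_, _, rfl⟩
    · exact (h' (isMax_bound _)).elim
    · exact (h' isMax_top).elim

theorem isMin_iff {x : CayleyPoset H} :
    IsMin x ↔ (∃ b g, x = vert b g) ∨ ∃ b, x = foot b := by
  constructor
  · intro h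
    cases x
    · exact .inl ⟨_, _, rfl⟩
    · exact .inr ⟨_, rfl⟩
    · rename_i b
      simpa [le_iff, le] using h (b := foot b) (by simp [le_iff, le])
    · exact ((exists_eq_arc_iff.mp ⟨_, _, rfl⟩).1 h).elim
    · simpa [le_iff, le] using h (b := foot false) (by simp [le_iff, le])
    · simpa [le_iff, le] using h (b := foot false) (by simp [le_iff, le])
  · rintro (⟨b, g, rfl⟩ | ⟨b, rfl⟩)
    · exact isMin_vert b g
    · exact isMin_foot b

theorem eq_top_iff_feet_le {x : CayleyPoset H} : (∀ b, foot b ≤ x) ↔ x = top := by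
  constructor
  · intro h
    have h0 := h false
    have h1 := h true
    cases x <;> simp_all [le_iff, le]
  · rintro rfl b
    simp [le_iff, le]

/-- `top` is the only element above all minimal elements. -/
theorem forall_isMin_le_iff {x : CayleyPoset H} : (∀ w, IsMin w → w ≤ x) ↔ x = top := by
  refine ⟨fun h => eq_top_iff_feet_le.mp fun b => h _ (isMin_foot b), ?_⟩
  rintro rfl w hw
  obtain ⟨b, g, rfl⟩ | ⟨b, rfl⟩ := isMin_iff.mp hw <;> simp [le_iff, le]

/-- The arc `arc g k` with its source and target, an element `bound a`, the feet, the caps and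
`top`. For `g⁻¹ * k ≤ a` this is a taut set, and these sets cover the poset. -/
def patch (g k a : H) : Set (CayleyPoset H) :=
  {vert false g, vert true k, foot false, foot true, cap false, cap true, arc g k, bound a, top}

theorem downTaut_patch (g k a : H) : DownTaut (patch g k a) := by
  rintro x (rfl | rfl | rfl | rfl | rfl | rfl | rfl | rfl | rfl)
  · exact .inl (isMin_vert _ _)
  · exact .inl (isMin_vert _ _)
  · exact .inl (isMin_foot _)
  · exact .inl (isMin_foot _)
  · refine .inr ⟨vert false g, by simp [patch], foot false, by simp [patch], ?_, ?_, ?_⟩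
    · simp [lt_iff_le_not_ge, le_iff, le]
    · simp [lt_iff_le_not_ge, le_iff, le]
    · rintro (_ | _ | _ | _ | _ | _) <;> simp [lt_iff_le_not_ge, le_iff, le]
  · refine .inr ⟨vert true k, by simp [patch], foot true, by simp [patch], ?_, ?_, ?_⟩
    · simp [lt_iff_le_not_ge, le_iff, le]
    · simp [lt_iff_le_not_ge, le_iff, le]
    · rintro (_ | _ | _ | _ | _ | _) <;> simp [lt_iff_le_not_ge, le_iff, le]
  · refine .inr ⟨vert false g, by simp [patch], vert true k, by simp [patch], ?_, ?_, ?_⟩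
    · simp [lt_iff_le_not_ge, le_iff, le]
    · simp [lt_iff_le_not_ge, le_iff, le]
    · rintro (_ | _ | _ | _ | _ | _) h h' h'' <;>
        simp only [lt_iff_le_not_ge, le_iff, le] at h h' h'' <;> grind
  · refine .inr ⟨vert false g, by simp [patch], foot false, by simp [patch], ?_, ?_, ?_⟩
    · simp [lt_iff_le_not_ge, le_iff, le]
    · simp [lt_iff_le_not_ge, le_iff, le]
    · rintro (_ | _ | _ | _ | _ | _) <;> simp +contextual [lt_iff_le_not_ge, le_iff, le]
  · refine .inr ⟨vert false g, by simp [patch], foot true, by simp [patch], ?_, ?_, ?_⟩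
    · simp [lt_iff_le_not_ge, le_iff, le]
    · simp [lt_iff_le_not_ge, le_iff, le]
    · rintro (_ | _ | _ | _ | _ | _) <;> simp +contextual [lt_iff_le_not_ge, le_iff, le]

theorem upTaut_patch {g k a : H} (h : g⁻¹ * k ≤ a) : UpTaut (patch g k a) := by
  rintro x (rfl | rfl | rfl | rfl | rfl | rfl | rfl | rfl | rfl)
  · refine .inr ⟨cap false, by simp [patch], arc g k, by simp [patch], ?_, ?_, ?_⟩
    · simp [lt_iff_le_not_ge, le_iff, le]
    · simp [lt_iff_le_not_ge, le_iff, le]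
    · rintro (_ | _ | _ | _ | _ | _) <;> simp +contextual [lt_iff_le_not_ge, le_iff, le]
  · refine .inr ⟨cap true, by simp [patch], arc g k, by simp [patch], ?_, ?_, ?_⟩
    · simp [lt_iff_le_not_ge, le_iff, le]
    · simp [lt_iff_le_not_ge, le_iff, le]
    · rintro (_ | _ | _ | _ | _ | _) <;> simp +contextual [lt_iff_le_not_ge, le_iff, le]
  · refine .inr ⟨cap false, by simp [patch], top, by simp [patch], ?_, ?_, ?_⟩
    · simp [lt_iff_le_not_ge, le_iff, le]
    · simp [lt_iff_le_not_ge, le_iff, le]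
    · rintro (_ | _ | _ | _ | _ | _) <;> simp +contextual [lt_iff_le_not_ge, le_iff, le]
  · refine .inr ⟨cap true, by simp [patch], top, by simp [patch], ?_, ?_, ?_⟩
    · simp [lt_iff_le_not_ge, le_iff, le]
    · simp [lt_iff_le_not_ge, le_iff, le]
    · rintro (_ | _ | _ | _ | _ | _) <;> simp +contextual [lt_iff_le_not_ge, le_iff, le]
  · exact .inl (isMax_cap _)
  · exact .inl (isMax_cap _)
  · refine .inr ⟨bound a, by simp [patch], top, by simp [patch], ?_, ?_, ?_⟩
    · simpa [lt_iff_le_not_ge, le_iff, le] using h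
    · simp [lt_iff_le_not_ge, le_iff, le]
    · rintro (_ | _ | _ | _ | _ | _) h h' h'' <;>
        simp only [lt_iff_le_not_ge, le_iff, le] at h h' h'' <;> grind
  · exact .inl (isMax_bound _)
  · exact .inl isMax_top

theorem eq_id_of_homotopic_id {f : C(CayleyPoset H, CayleyPoset H)}
    (hf : f.Homotopic (ContinuousMap.id _)) : f = ContinuousMap.id _ := by
  refine _root_.eq_id_of_homotopic_id (fun x => ?_) hf
  suffices h : ∃ g k a, g⁻¹ * k ≤ a ∧ x ∈ patch g k a by
    obtain ⟨g, k, a, h, hx⟩ := h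
    exact ⟨_, hx, by simp [patch], downTaut_patch g k a, upTaut_patch h⟩
  obtain (_ | g) | (_ | _) | (_ | _) | ⟨g, k⟩ | a | _ := x
  · rename_i g
    exact ⟨g, 1, _, le_rfl, by simp [patch]⟩
  · rename_i g
    exact ⟨1, g, _, le_rfl, by simp [patch]⟩
  · exact ⟨1, 1, _, le_rfl, by simp [patch]⟩
  · exact ⟨1, 1, _, le_rfl, by simp [patch]⟩
  · exact ⟨1, 1, _, le_rfl, by simp [patch]⟩
  · exact ⟨1, 1, _, le_rfl, by simp [patch]⟩
  · exact ⟨g, k, _, le_rfl, by simp [patch]⟩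
  · exact ⟨1, a, a, by simp, by simp [patch]⟩
  · exact ⟨1, 1, _, le_rfl, by simp [patch]⟩

/-! ### Automorphisms of the Cayley poset -/

/-- Left translations are order automorphisms, since they preserve the colours of the arcs. -/
def translateHom : H →* (CayleyPoset H ≃o CayleyPoset H) where
  toFun h :=
    { toFun := translate h
      invFun := translate h⁻¹
      left_inv := fun x => by rw [← translate_mul, inv_mul_cancel, translate_one]
      right_inv := fun x => by rw [← translate_mul, mul_inv_cancel, translate_one]
      map_rel_iff' := by
        rintro (⟨_ | _, _⟩ | _ | _ | _ | _ | _) (_ | _ | _ | _ | _ | _) <;>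
          simp [translate, le_iff, le, mul_assoc] }
  map_one' := by ext x; exact translate_one x
  map_mul' h h' := by ext x; exact translate_mul h h' x

section Automorphism

variable (φ : CayleyPoset H ≃o CayleyPoset H)

/-- The arcs are the elements that are neither minimal nor maximal. -/
theorem exists_map_arc (g k : H) : ∃ g' k', φ (arc g k) = arc g' k' := by
  rw [exists_eq_arc_iff, φ.isMin_apply, φ.isMax_apply]
  exact exists_eq_arc_iff.mp ⟨g, k, rfl⟩

/-- The feet are the minimal elements that lie below no arc. -/
theorem exists_map_foot (b : Bool) : ∃ b', φ (foot b) = foot b' := by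
  obtain ⟨b', g, h⟩ | h := isMin_iff.mp (φ.isMin_apply.mpr (isMin_foot b))
  · obtain ⟨x, y, hxy⟩ := exists_map_arc φ.symm g g
    have hle : φ (foot b) ≤ arc g g := by
      rw [h]
      cases b' <;> simp [le_iff, le]
    rw [← φ.le_symm_apply, hxy] at hle
    simp [le_iff, le] at hle
  · exact h

/-- `top` is the only element above two different feet. -/
theorem map_top : φ top = top := by
  have hne : ∀ x : CayleyPoset H, ∀ b b', b ≠ b' → foot b ≤ x → foot b' ≤ x → x = top := by
    intro x b b' hb h h'
    refine eq_top_iff_feet_le.mp fun c => ?_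
    cases b <;> cases b' <;> cases c <;> simp_all
  obtain ⟨b, hb⟩ := exists_map_foot φ false
  obtain ⟨b', hb'⟩ := exists_map_foot φ true
  refine hne _ b b' ?_ ?_ ?_
  · rintro rfl
    have := φ.injective (hb.trans hb'.symm)
    simp at this
  · rw [← hb, φ.le_iff_le]
    simp [le_iff, le]
  · rw [← hb', φ.le_iff_le]
    simp [le_iff, le]

/-- Besides `top`, the elements `bound a` are the only maximal elements above an arc. -/
theorem exists_map_bound (a : H) : ∃ a', φ (bound a) = bound a' := by
  have hmax := φ.isMax_apply.mpr (isMax_bound a)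
  have htop : φ (bound a) ≠ top := fun h => by
    have := φ.injective (h.trans (map_top φ).symm)
    simp at this
  obtain ⟨g, k, hgk⟩ := exists_map_arc φ 1 a
  have hle : arc g k ≤ φ (bound a) := by
    rw [← hgk, φ.le_iff_le]
    simp [le_iff, le]
  rcases h : φ (bound a) with _ | _ | _ | ⟨x, y⟩ | a' | _
  all_goals rw [h] at hmax htop hle
  · simp [le_iff, le] at hle
  · simp [le_iff, le] at hle
  · simp [le_iff, le] at hle
  · exact ((exists_eq_arc_iff.mp ⟨x, y, rfl⟩).2 hmax).elim
  · exact ⟨a', rfl⟩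
  · exact (htop rfl).elim

/-- The feet are not interchanged, since only `foot false` lies below the elements `bound a`. -/
theorem map_foot (b : Bool) : φ (foot b) = foot b := by
  have h0 : φ (foot false) = foot false := by
    obtain ⟨b, hb⟩ := exists_map_foot φ false
    obtain ⟨a, ha⟩ := exists_map_bound φ 1
    have hle : φ (foot false) ≤ φ (bound 1) := by
      rw [φ.le_iff_le]
      simp [le_iff, le]
    rw [hb, ha] at hle
    have : b = false := hle
    rw [hb, this]
  cases b
  · exact h0
  · obtain ⟨b, hb⟩ := exists_map_foot φ true
    cases b
    · have := φ.injective (hb.trans h0.symm)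
      simp at this
    · exact hb

theorem map_cap (b : Bool) : φ (cap b) = cap b := by
  have hmax := φ.isMax_apply.mpr (isMax_cap b)
  have hle : foot b ≤ φ (cap b) := by
    rw [← map_foot φ b, φ.le_iff_le]
    simp [le_iff, le]
  rcases h : φ (cap b) with _ | _ | b' | ⟨x, y⟩ | a' | _
  all_goals rw [h] at hmax hle
  · simp [le_iff, le] at hle
  · exact absurd (hmax (b := top) (by simp [le_iff, le])) (by simp [le_iff, le])
  · have : b = b' := hle
    rw [this]
  · exact ((exists_eq_arc_iff.mp ⟨x, y, rfl⟩).2 hmax).elim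
  · obtain ⟨a, ha⟩ := exists_map_bound φ.symm a'
    rw [← h, φ.symm_apply_apply] at ha
    cases ha
  · have := φ.injective (h.trans (map_top φ).symm)
    simp at this

theorem exists_map_vert (b : Bool) (g : H) : ∃ g', φ (vert b g) = vert b g' := by
  obtain ⟨b', g', h⟩ | ⟨b', h⟩ := isMin_iff.mp (φ.isMin_apply.mpr (isMin_vert b g))
  · have hle : φ (vert b g) ≤ φ (cap b) := by
      rw [φ.le_iff_le]
      simp [le_iff, le]
    rw [h, map_cap] at hle
    have : b' = b := hle
    exact ⟨g', by rw [h, this]⟩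
  · have := φ.injective (h.trans (map_foot φ b').symm)
    simp at this

/-- The order on the colours is visible in the elements `bound a`; being a
well-order, it leaves no room for an automorphism to permute the colours. -/
theorem map_bound [WellFoundedLT H] (a : H) : φ (bound a) = bound a := by
  choose t ht using exists_map_bound φ
  choose t' ht' using exists_map_bound φ.symm
  have hmono : ∀ (ψ : CayleyPoset H ≃o CayleyPoset H) (a b a' b' : H), ψ (bound a) = bound a' →
      ψ (bound b) = bound b' → a' ≤ b' → a ≤ b := by
    intro ψ a b a' b' ha hb h
    obtain ⟨g, k, hgk⟩ := exists_map_arc ψ 1 a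
    have h1 : ψ (arc 1 a) ≤ ψ (bound a) := by
      rw [ψ.le_iff_le]
      simp [le_iff, le]
    rw [hgk, ha] at h1
    have h2 : ψ (arc 1 a) ≤ ψ (bound b) := by
      rw [hgk, hb]
      exact le_trans (α := H) h1 h
    rw [ψ.le_iff_le] at h2
    simpa [le_iff, le] using h2
  let e : H ≃o H :=
    { toFun := t
      invFun := t'
      left_inv := fun a => bound.inj (by rw [← ht', ← ht, φ.symm_apply_apply])
      right_inv := fun a => bound.inj (by rw [← ht, ← ht', φ.apply_symm_apply])
      map_rel_iff' := fun {a b} => ⟨hmono φ a b _ _ (ht a) (ht b),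
        hmono φ.symm (t a) (t b) a b (by rw [← ht, φ.symm_apply_apply])
          (by rw [← ht, φ.symm_apply_apply])⟩ }
  have he : e a = a := by rw [Subsingleton.elim e (OrderIso.refl H)]; rfl
  rw [ht]
  exact congrArg bound he

theorem exists_eq_translateHom [WellFoundedLT H] : ∃ h, translateHom h = φ := by
  choose s hs using exists_map_vert φ
  have harc : ∀ g k, φ (arc g k) = arc (s false g) (s true k) := fun g k => by
    obtain ⟨g', k', h⟩ := exists_map_arc φ g k
    have h1 : φ (vert false g) ≤ φ (arc g k) := by
      rw [φ.le_iff_le]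
      simp [le_iff, le]
    have h2 : φ (vert true k) ≤ φ (arc g k) := by
      rw [φ.le_iff_le]
      simp [le_iff, le]
    rw [hs, h] at h1 h2
    have h1 : s false g = g' := h1
    have h2 : s true k = k' := h2
    rw [h, h1, h2]
  -- Arcs are mapped to arcs of the same colour, because the elements `bound a` are fixed.
  have hcol : ∀ g k, (s false g)⁻¹ * s true k = g⁻¹ * k := fun g k => by
    refine eq_of_forall_ge_iff fun a => ?_
    have : φ (arc g k) ≤ φ (bound a) ↔ _ := φ.le_iff_le
    rwa [harc, map_bound] at this
  have h1 : ∀ k, s true k = s false 1 * k := fun k => by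
    have := hcol 1 k
    rw [inv_one, one_mul] at this
    exact eq_mul_of_inv_mul_eq this
  have h0 : ∀ g, s false g = s false 1 * g := fun g => by
    have := hcol g g
    rw [inv_mul_cancel, inv_mul_eq_one] at this
    rw [this, h1]
  refine ⟨s false 1, ?_⟩
  ext (⟨_ | _, g⟩ | b | b | ⟨g, k⟩ | a | _)
  · exact (congrArg (vert false) (h0 g)).symm.trans (hs _ _).symm
  · exact (congrArg (vert true) (h1 g)).symm.trans (hs _ _).symm
  · exact (map_foot φ b).symm
  · exact (map_cap φ b).symm
  · exact (congrArg₂ arc (h0 g) (h1 k)).symm.trans (harc g k).symm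
  · exact (map_bound φ a).symm
  · exact (map_top φ).symm

end Automorphism

theorem nonempty_mulEquiv_orderIso [WellFoundedLT H] :
    Nonempty (H ≃* (CayleyPoset H ≃o CayleyPoset H)) := by
  refine ⟨MulEquiv.ofBijective translateHom
    ⟨(injective_iff_map_eq_one _).mpr fun h hh => ?_, fun φ => exists_eq_translateHom φ⟩⟩
  have : translate h (vert false 1) = vert false 1 :=
    DFunLike.congr_fun hh (vert false 1)
  simpa [translate] using this

end CayleyPoset

/-! ### Breaking the symmetry without changing the homotopy type -/

/-- For each `g : H`, a chain of the order type of the elements up to `g`, to be placed above the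
vertex `vert false g` of the Cayley poset. -/
def chainBase (H : Type u) [Group H] [LinearOrder H] : (Σ g : H, Set.Iic g) →o CayleyPoset H where
  toFun x := .vert false x.1
  monotone' := by
    rintro _ _ ⟨g, a, b, h⟩
    exact le_rfl

/-- The Cayley poset with a chain of the order type of `Set.Iic g` attached above each vertex
`vert false g`. -/
abbrev RigidCayleyPoset (H : Type u) [Group H] [LinearOrder H] : Type u :=
  MapCylinder (chainBase H)

namespace RigidCayleyPoset

open MapCylinder

variable {H : Type u} [Group H] [LinearOrder H]

/-- The chains do not disturb the characterisation of `top`, the point where the second poset is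
attached. -/
theorem forall_isMin_le_iff {x : RigidCayleyPoset H} :
    (∀ w, IsMin w → w ≤ x) ↔ x = base .top := by
  constructor
  · intro h
    have h' : ∀ w : CayleyPoset H, IsMin w → base w ≤ x := fun w hw =>
      h _ (MapCylinder.isMin_iff.mpr ⟨w, hw, rfl⟩)
    obtain x | t := x
    · exact congrArg base (CayleyPoset.forall_isMin_le_iff.mp h')
    · exact (h' _ (CayleyPoset.isMin_foot false)).elim
  · rintro rfl w hw
    obtain ⟨y, hy, rfl⟩ := MapCylinder.isMin_iff.mp hw
    exact CayleyPoset.forall_isMin_le_iff.mpr rfl y hy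

/-- The elements of the chains are those that are not minimal and lie above a single minimal
element. -/
theorem mem_range_base_iff {x : RigidCayleyPoset H} :
    x ∈ Set.range (base (c := chainBase H)) ↔
      (IsMin x ∨ ∃ w w', w ≠ w' ∧ IsMin w ∧ IsMin w' ∧ w ≤ x ∧ w' ≤ x) := by
  have hmin : ∀ w : CayleyPoset H, IsMin w → IsMin (base w : RigidCayleyPoset H) := fun w hw =>
    MapCylinder.isMin_iff.mpr ⟨w, hw, rfl⟩
  constructor
  · rintro ⟨x, rfl⟩
    have two : ∀ w w' : CayleyPoset H, w ≠ w' → IsMin w → IsMin w' → w ≤ x → w' ≤ x →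
        (IsMin (base x : RigidCayleyPoset H) ∨ ∃ w w' : RigidCayleyPoset H,
          w ≠ w' ∧ IsMin w ∧ IsMin w' ∧ w ≤ base x ∧ w' ≤ base x) :=
      fun w w' h hw hw' hx hx' =>
        .inr ⟨base w, base w', fun e => h (base.inj e), hmin w hw, hmin w' hw', hx, hx'⟩
    rcases x with ⟨b, g⟩ | b | b | ⟨g, k⟩ | a | _
    · exact .inl (hmin _ (CayleyPoset.isMin_vert b g))
    · exact .inl (hmin _ (CayleyPoset.isMin_foot b))
    · exact two (.foot b) (.vert b 1) (by simp) (CayleyPoset.isMin_foot _)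
        (CayleyPoset.isMin_vert _ _) (by simp [CayleyPoset.le_iff, CayleyPoset.le])
        (by simp [CayleyPoset.le_iff, CayleyPoset.le])
    · exact two (.vert false g) (.vert true k) (by simp) (CayleyPoset.isMin_vert _ _)
        (CayleyPoset.isMin_vert _ _) (by simp [CayleyPoset.le_iff, CayleyPoset.le])
        (by simp [CayleyPoset.le_iff, CayleyPoset.le])
    · exact two (.foot false) (.vert false 1) (by simp) (CayleyPoset.isMin_foot _)
        (CayleyPoset.isMin_vert _ _) (by simp [CayleyPoset.le_iff, CayleyPoset.le])
        (by simp [CayleyPoset.le_iff, CayleyPoset.le])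
    · exact two (.foot false) (.vert false 1) (by simp) (CayleyPoset.isMin_foot _)
        (CayleyPoset.isMin_vert _ _) (by simp [CayleyPoset.le_iff, CayleyPoset.le])
        (by simp [CayleyPoset.le_iff, CayleyPoset.le])
  · obtain x | t := x
    · exact fun _ => ⟨x, rfl⟩
    · rintro (h | ⟨w, w', hne, hw, hw', h, h'⟩)
      · obtain ⟨y, _, hy⟩ := MapCylinder.isMin_iff.mp h
        cases hy
      · obtain ⟨y, _, rfl⟩ := MapCylinder.isMin_iff.mp hw
        obtain ⟨y', _, rfl⟩ := MapCylinder.isMin_iff.mp hw'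
        have hy : y = .vert false t.1 := (CayleyPoset.isMin_vert _ _).eq_of_le h
        have hy' : y' = .vert false t.1 := (CayleyPoset.isMin_vert _ _).eq_of_le h'
        exact (hne (by rw [hy, hy'])).elim

/-- Automorphisms preserve the Cayley poset inside the rigid Cayley poset. -/
theorem mem_range_base_iff_map (φ : RigidCayleyPoset H ≃o RigidCayleyPoset H)
    (x : RigidCayleyPoset H) :
    x ∈ Set.range (base (c := chainBase H)) ↔ φ x ∈ Set.range (base (c := chainBase H)) := by
  have key : ∀ (ψ : RigidCayleyPoset H ≃o RigidCayleyPoset H) (y : RigidCayleyPoset H),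
      y ∈ Set.range (base (c := chainBase H)) → ψ y ∈ Set.range (base (c := chainBase H)) := by
    intro ψ y hy
    rw [mem_range_base_iff] at hy ⊢
    refine hy.imp (fun h => ψ.isMin_apply.mpr h) ?_
    rintro ⟨w, w', hne, hw, hw', h, h'⟩
    exact ⟨ψ w, ψ w', ψ.injective.ne hne, ψ.isMin_apply.mpr hw, ψ.isMin_apply.mpr hw',
      ψ.monotone h, ψ.monotone h'⟩
  exact ⟨key φ x, fun h => by simpa using key φ.symm _ h⟩

/-- An automorphism acts on the Cayley poset by translation by some `h`, and
carries the chain at `g` onto the chain at `h * g`. In a well-order, `Set.Iic g` and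
`Set.Iic (h * g)` are isomorphic only if `g = h * g`, and then only by the identity. -/
theorem subsingleton_orderIso [WellFoundedLT H] :
    Subsingleton (RigidCayleyPoset H ≃o RigidCayleyPoset H) := by
  suffices hid : ∀ φ : RigidCayleyPoset H ≃o RigidCayleyPoset H, φ = OrderIso.refl _ from
    ⟨fun φ ψ => (hid φ).trans (hid ψ).symm⟩
  intro φ
  obtain ⟨σ, τ, hc, rfl⟩ := exists_eq_orderIso φ (mem_range_base_iff_map φ)
  obtain ⟨h, rfl⟩ := CayleyPoset.exists_eq_translateHom σ
  have hfst : ∀ t, (τ t).1 = h * t.1 := fun t => (CayleyPoset.vert.inj (hc t)).2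
  have hbnd : ∀ t, ((τ t).2 : H) ≤ h * t.1 := fun t => (τ t).2.2.trans_eq (hfst t)
  have hsnd : ∀ t, ((τ t).2 : H) = t.2 := by
    rintro ⟨g, b⟩
    have hle : ∀ (s t : Σ g : H, Set.Iic g), s ≤ t ↔ s.1 = t.1 ∧ (s.2 : H) ≤ t.2 := by
      rintro ⟨i, a⟩ ⟨j, b⟩
      constructor
      · rintro ⟨_, _, _, h⟩
        exact ⟨rfl, h⟩
      · rintro ⟨hij, hab⟩
        obtain rfl : i = j := hij
        exact Sigma.LE.fiber _ _ _ hab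
    -- Both `τ` on the chain at `g` and the inclusion are initial segment embeddings into `H`, and
    -- there is at most one such embedding.
    let e : Set.Iic g ↪o H := OrderEmbedding.ofMapLEIff (fun b => ((τ ⟨g, b⟩).2 : H)) fun a b => by
      have h1 := hle (τ ⟨g, a⟩) (τ ⟨g, b⟩)
      rw [τ.le_iff_le, Sigma.mk_le_mk_iff] at h1
      exact ⟨fun h => h1.mpr ⟨(hfst ⟨g, a⟩).trans (hfst ⟨g, b⟩).symm, h⟩, fun h => (h1.mp h).2⟩
    let i : Set.Iic g ≤i H := ⟨e.ltEmbedding, fun a x hx => by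
      have hx' : x ≤ h * g := (le_of_lt hx).trans (hbnd ⟨g, a⟩)
      obtain ⟨⟨g', a'⟩, ht⟩ := τ.surjective ⟨h * g, x, hx'⟩
      have hg : g' = g := by
        have := hfst ⟨g', a'⟩
        rw [ht] at this
        exact (mul_left_cancel this).symm
      subst hg
      have ha' : ((τ ⟨g', a'⟩).2 : H) = x := by rw [ht]
      exact ⟨a', ha'⟩⟩
    let incl : Set.Iic g ↪o H := OrderEmbedding.subtype _
    let j : Set.Iic g ≤i H := ⟨incl.ltEmbedding, fun a x hx =>
      ⟨⟨x, (le_of_lt (show x < (a : H) from hx)).trans a.2⟩, rfl⟩⟩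
    exact InitialSeg.eq i j b
  -- Compare the greatest elements of the chain at `1` and of its image, the chain at `h`.
  have hh : h = 1 := by
    have h1 : (1 : H) ≤ h := by
      have := hbnd ⟨1, 1, Set.mem_Iic.mpr le_rfl⟩
      rwa [hsnd, mul_one] at this
    obtain ⟨⟨g, a⟩, ht⟩ := τ.surjective ⟨h * 1, h * 1, Set.mem_Iic.mpr le_rfl⟩
    have hg := hfst ⟨g, a⟩
    have ha := hsnd ⟨g, a⟩
    rw [ht] at hg ha
    have hg : 1 = g := mul_left_cancel hg
    have ha : h * 1 = a := ha
    have h2 : h ≤ 1 := by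
      rw [mul_one] at ha
      rw [ha, hg]
      exact a.2
    exact le_antisymm h2 h1
  subst hh
  ext (x | t)
  · exact congrArg base (CayleyPoset.translate_one x)
  · refine congrArg tail (?_ : τ t = t)
    refine Sigma.subtype_ext ?_ (hsnd t)
    rw [hfst, one_mul]

end RigidCayleyPoset

/-! ### The realization theorem -/

theorem mainTheorem2 (G : Type u) (H : Type v) [Group G] [Group H] :
    ∃ (X : Type (max u v)) (_ : PartialOrder X) (_ : TopologicalSpace X),
      -- `X` is a poset with the topology of lower sets, i.e. a `T₀` Alexandroff space
      Topology.IsLowerSet X ∧ AlexandrovDiscrete X ∧ T0Space X ∧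
      Nonempty ((X ≃ₜ X) ≃* G) ∧
      Nonempty (SelfHomotopyGroup X ≃* H) ∧
      -- `X` is glued, at one point, from a contractible poset `Y` and a poset `Z`
      ∃ (Y : Type u) (_ : PartialOrder Y) (_ : TopologicalSpace Y)
        (Z : Type v) (_ : PartialOrder Z) (_ : TopologicalSpace Z)
        (i : Y ↪o X) (j : Z ↪o X) (y₀ : Y) (z₀ : Z),
        Topology.IsLowerSet Y ∧ Topology.IsLowerSet Z ∧
        IsPointGluing i j y₀ z₀ ∧
        (∀ y : Y, y₀ ≤ y) ∧ ContractibleSpace Y ∧ Nonempty ((Y ≃ₜ Y) ≃* G) ∧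
        Subsingleton (Z ≃ₜ Z) ∧ Nonempty (SelfHomotopyGroup Z ≃* H) := by
  obtain ⟨_, _⟩ := exists_wellFoundedLT G
  obtain ⟨_, _⟩ := exists_wellFoundedLT H
  let A := CayleyPoset G
  let Z := RigidCayleyPoset H
  let z₀ : Z := .base .top
  let Y := MapCylinder (OrderHom.const A PUnit.unit.{u + 1})
  let X := MapCylinder (OrderHom.const A z₀)
  have hZrigid : Subsingleton (Z ≃o Z) := RigidCayleyPoset.subsingleton_orderIso
  have hpt : Topology.IsLowerSet PUnit.{u + 1} := ⟨Subsingleton.elim _ _⟩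
  obtain ⟨eA⟩ := CayleyPoset.nonempty_mulEquiv_orderIso (H := G)
  obtain ⟨eH⟩ := CayleyPoset.nonempty_mulEquiv_orderIso (H := H)
  obtain ⟨eY⟩ := MapCylinder.nonempty_orderIso_mulEquiv_of_const (A := A)
    (z₀ := PUnit.unit.{u + 1}) fun _ => by simp
  obtain ⟨eX⟩ := MapCylinder.nonempty_orderIso_mulEquiv_of_const (A := A) (z₀ := z₀)
    fun _ => RigidCayleyPoset.forall_isMin_le_iff
  obtain ⟨hY⟩ := MapCylinder.nonempty_homotopyEquiv (c := OrderHom.const A PUnit.unit.{u + 1})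
  obtain ⟨hX⟩ := MapCylinder.nonempty_homotopyEquiv (c := OrderHom.const A z₀)
  obtain ⟨hZ⟩ := MapCylinder.nonempty_homotopyEquiv (c := chainBase H)
  obtain ⟨eE⟩ := SelfHomotopyGroup.nonempty_homeomorph_mulEquiv (X := CayleyPoset H)
    fun _ => CayleyPoset.eq_id_of_homotopic_id
  let eZH : SelfHomotopyGroup Z ≃* H := (SelfHomotopyGroup.congr hZ).trans <| eE.symm.trans <|
    homeomorphMulEquivOrderIso.trans eH.symm
  let i : Y ↪o X := OrderEmbedding.ofMapLEIff
    (fun y => match y with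
      | .base _ => .base z₀
      | .tail a => .tail a)
    (by
      rintro (x | a) (y | b)
      · simp
      · exact iff_of_true (le_refl z₀) (le_refl PUnit.unit.{u + 1})
      · exact Iff.rfl
      · exact Iff.rfl)
  let j : Z ↪o X := OrderEmbedding.ofMapLEIff .base fun _ _ => Iff.rfl
  refine ⟨X, inferInstance, inferInstance, inferInstance, Topology.IsLowerSet.toAlexandrovDiscrete,
    Topology.IsLowerSet.t0Space, ⟨homeomorphMulEquivOrderIso.trans (eX.trans eA.symm)⟩,
    ⟨(SelfHomotopyGroup.congr hX).trans eZH⟩, Y, inferInstance, inferInstance, Z, inferInstance,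
    inferInstance, i, j, .base PUnit.unit, z₀, inferInstance, inferInstance, ?_, ?_,
    hY.contractibleSpace, ⟨homeomorphMulEquivOrderIso.trans (eY.trans eA.symm)⟩,
    homeomorphMulEquivOrderIso.toEquiv.subsingleton, ⟨eZH⟩⟩
  · refine ⟨?_, ?_, rfl, ?_, ?_⟩
    · refine Set.eq_univ_of_forall ?_
      rintro (z | a)
      · exact .inr ⟨z, rfl⟩
      · exact .inl ⟨.tail a, rfl⟩
    · ext w
      constructor
      · rintro ⟨⟨x | a, rfl⟩, ⟨z, hz⟩⟩
        · rfl
        · cases hz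
      · rintro rfl
        exact ⟨⟨.base PUnit.unit, rfl⟩, ⟨z₀, rfl⟩⟩
    · rintro z (x | a)
      · exact ⟨fun h => ⟨h, le_rfl⟩, fun h => h.1⟩
      · exact ⟨fun h => ⟨h, le_refl PUnit.unit.{u + 1}⟩, fun h => h.1⟩
    · rintro (x | a) z
      · exact ⟨fun h => ⟨le_rfl, h⟩, fun h => h.2⟩
      · exact ⟨fun h => h.elim, fun h => h.1.elim⟩
  · rintro (x | a)
    · exact le_refl (MapCylinder.base x)
    · exact le_refl PUnit.unit.{u + 1}
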